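/- Let $1\le k\le d$, $t\ge 0$ and $n\ge 1$ be integers. For real $d\times d$ matrices put $\langle M_1,M_2\rangle:=\operatorname{trace}(M_1M_2)$, and let $$\mathcal G_{k,d}:=\{P\in\mathbb R^{d\times d}: P^\top=P,\ P^2=P,\ \operatorname{trace}(P)=k\}$$ be the set of rank-$k$ orthogonal projections on $\mathbb R^d$. Let $\sigma_{k,d}$ be the probability measure on $\mathcal G_{k,d}$, invariant under $P\mapsto UPU^\top$ for $U\in\mathcal O(d)$, that is induced by the Haar measure on the orthogonal group $\mathcal O(d)$. Let $\mathrm{Pol}_t(\mathcal G_{k,d})$ be the space of restrictions to $\mathcal G_{k,d}$ of real polynomials of degree at most $t$ in the matrix entries. A Borel probability measure $\nu$ on $\mathcal G_{k,d}$ is called a probabilistic cubature for $\mathrm{Pol}_t(\mathcal G_{k,d})$ if $\int f\,d\nu=\int f\,d\sigma_{k,d}$ for all $f\in\mathrm{Pol}_t(\mathcal G_{k,d})$. Put $K_t(P,Q):=\langle P,Q\rangle^t$ and $$\lambda_t:=\int_{\mathcal G_{k,d}}\int_{\mathcal G_{k,d}}K_t(P,P')\,d\sigma_{k,d}(P)\,d\sigma_{k,d}(P').$$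 **Theorem.** If $P_1,\dots,P_n$ are independent and identically distributed random projections whose common law $\nu$ is a probabilistic cubature for $\mathrm{Pol}_t(\mathcal G_{k,d})$, and $\tau>0$, then $$\mathbb P\Big(\frac1{n^2}\sum_{i,j=1}^nK_t(P_i,P_j)-\lambda_t-\frac1n\,(k^t-\lambda_t)\ \ge\ \frac{\tau^2k^t}{n}\Big)\ \le\ 4\,e^{-\Psi_\tau(n)}\,r_\tau(n),$$ where $$\Psi_\tau(n)=\frac{\tau^2/2}{(1-\lambda_t/k^t)+\frac{\tau}{3\sqrt n}},\qquad r_\tau(n)=1+\frac{6}{n\,\tau^2\,\ln^2\!\Big(1+\frac{\tau}{\sqrt n\,(1-\lambda_t/k^t)}\Big)}.$$ If $\lambda_t=k^t$ (for example if $t=0$ or $k=d$), the last fraction is read as $0$, so that $r_\tau(n)=1$. -/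

import Mathlib

open MeasureTheory ProbabilityTheory

namespace GrassmannCubature

/-- The Grassmann space of rank-`k` orthogonal projections on `ℝ^d`: symmetric idempotent real
`d × d` matrices of trace `k`, with the subspace topology. -/
abbrev Grass (k d : ℕ) : Type :=
  {P : Matrix (Fin d) (Fin d) ℝ // P.transpose = P ∧ P * P = P ∧ P.trace = k}

instance instMeasurableSpaceGrass (k d : ℕ) : MeasurableSpace (Grass k d) := borel _

instance instBorelSpaceGrass (k d : ℕ) : BorelSpace (Grass k d) := ⟨rfl⟩

/-- The real orthogonal group `O(d)`. -/
abbrev Orth (d : ℕ) : Type := Matrix.orthogonalGroup (Fin d) ℝ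

instance instMeasurableSpaceOrth (d : ℕ) : MeasurableSpace (Orth d) := borel _

instance instBorelSpaceOrth (d : ℕ) : BorelSpace (Orth d) := ⟨rfl⟩

instance instCompactSpaceOrth (d : ℕ) : CompactSpace (Orth d) := by
  refine isCompact_iff_compactSpace.mp ?_
  have hc : IsCompact (Set.univ.pi fun _ : Fin d => Set.univ.pi fun _ : Fin d =>
      Set.Icc (-1 : ℝ) 1) :=
    isCompact_univ_pi fun _ => isCompact_univ_pi fun _ => isCompact_Icc
  refine IsCompact.of_isClosed_subset (X := Matrix (Fin d) (Fin d) ℝ) hc ?_ ?_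
  · have : (Matrix.orthogonalGroup (Fin d) ℝ : Set (Matrix (Fin d) (Fin d) ℝ)) =
        {A | A * star A = 1} := by
      ext A
      exact Matrix.mem_unitaryGroup_iff
    rw [this]
    exact isClosed_eq (by fun_prop) continuous_const
  · intro A hA i _ j _
    have h := entry_norm_bound_of_unitary hA i j
    rw [Real.norm_eq_abs] at h
    exact abs_le.mp h

/-- The diagonal matrix `D_k` with `k` leading ones, as a point of the Grassmann space. -/
noncomputable def baseProj {k d : ℕ} (hkd : k ≤ d) : Grass k d :=
  ⟨Matrix.diagonal fun i : Fin d => if (i : ℕ) < k then 1 else 0, by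
    refine ⟨Matrix.diagonal_transpose _, ?_, ?_⟩
    · rw [Matrix.diagonal_mul_diagonal]
      congr 1
      ext i
      split_ifs <;> simp
    · have hf : (Finset.univ.filter fun i : Fin d => (i : ℕ) < k).card = k := by
        rw [Fin.card_filter_val_lt]
        exact min_eq_right hkd
      rw [Matrix.trace_diagonal, Finset.sum_boole, hf]⟩

/-- The action of `O(d)` on the Grassmann space by conjugation, `(U, P) ↦ U P U^*`. -/
def conj {k d : ℕ} (U : Orth d) (P : Grass k d) : Grass k d :=
  ⟨U.1 * P.1 * U.1.transpose, by
    have hU : U.1.transpose * U.1 = 1 := by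
      have h := Matrix.mem_unitaryGroup_iff'.mp U.2
      rwa [Matrix.star_eq_conjTranspose, Matrix.conjTranspose_eq_transpose_of_trivial] at h
    obtain ⟨h1, h2, h3⟩ := P.2
    refine ⟨?_, ?_, ?_⟩
    · rw [Matrix.transpose_mul, Matrix.transpose_mul, Matrix.transpose_transpose, h1, mul_assoc]
    · calc U.1 * P.1 * U.1.transpose * (U.1 * P.1 * U.1.transpose)
          = U.1 * P.1 * (U.1.transpose * U.1) * P.1 * U.1.transpose := by noncomm_ring
        _ = U.1 * P.1 * U.1.transpose := by rw [hU, mul_one, mul_assoc U.1 P.1 P.1, h2]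
    · rw [Matrix.trace_mul_comm, ← mul_assoc, hU, one_mul, h3]⟩

/-- The normalized Haar measure on `O(d)`. -/
noncomputable def haarOrth (d : ℕ) : Measure (Orth d) := Measure.haarMeasure ⊤

/-- The orthogonally invariant probability measure `σ_{k,d}` on the Grassmann space, induced by
the Haar measure on `O(d)`. -/
noncomputable def sigma {k d : ℕ} (hkd : k ≤ d) : Measure (Grass k d) :=
  (haarOrth d).map fun U => conj U (baseProj hkd)

/-- `Pol_t`: real polynomials of degree at most `t` in the matrix entries, restricted to the
Grassmann space. -/
def Pol (k d t : ℕ) : Set (Grass k d → ℝ) :=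
  {f | ∃ p : MvPolynomial (Fin d × Fin d) ℝ, p.totalDegree ≤ t ∧
    ∀ P : Grass k d, f P = MvPolynomial.eval (fun ij => P.1 ij.1 ij.2) p}

/-- A Borel probability measure `ν` on the Grassmann space is a probabilistic cubature for `Pol_t`
if it integrates every element of `Pol_t` like `σ_{k,d}` does. -/
structure IsProbabilisticCubature {k d : ℕ} (hkd : k ≤ d) (t : ℕ) (ν : Measure (Grass k d)) :
    Prop where
  isProbabilityMeasure : IsProbabilityMeasure ν
  integral_eq : ∀ f ∈ Pol k d t, ∫ P, f P ∂ν = ∫ P, f P ∂(sigma hkd)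

/-- The kernel `K_t(P, Q) = ⟨P, Q⟩^t = trace(P Q)^t`. -/
def kernelK {k d : ℕ} (t : ℕ) (P Q : Grass k d) : ℝ := (P.1 * Q.1).trace ^ t

/-- `λ_t = ∫∫ K_t(P, P') dσ(P) dσ(P')`. -/
noncomputable def lam {k d : ℕ} (hkd : k ≤ d) (t : ℕ) : ℝ :=
  ∫ Q, ∫ P, kernelK t P Q ∂(sigma hkd) ∂(sigma hkd)

/-- `Ψ_τ(n) = (τ²/2) / ((1 - λ_t/k^t) + τ/(3√n))`. -/
noncomputable def Psi {k d : ℕ} (hkd : k ≤ d) (t : ℕ) (τ : ℝ) (n : ℕ) : ℝ :=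
  (τ ^ 2 / 2) / ((1 - lam hkd t / (k : ℝ) ^ t) + τ / (3 * √(n : ℝ)))

/-- `r_τ(n) = 1 + 6 / (n τ² ln²(1 + τ / (√n (1 - λ_t/k^t))))`. If `λ_t = k^t`, the inner quotient is
formally `τ / 0 = +∞` and `r_τ(n) = 1`; Lean's conventions `τ / 0 = 0`, `log 1 = 0`, `6 / 0 = 0`
yield the same value. -/
noncomputable def rTau {k d : ℕ} (hkd : k ≤ d) (t : ℕ) (τ : ℝ) (n : ℕ) : ℝ :=
  1 + 6 / ((n : ℝ) * τ ^ 2 *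
    Real.log (1 + τ / (√(n : ℝ) * (1 - lam hkd t / (k : ℝ) ^ t))) ^ 2)

end GrassmannCubature

open GrassmannCubature

open GrassmannCubature

/-! The kernel is an inner product, `K_t(P, Q) = ⟨P^{⊗t}, Q^{⊗t}⟩`. Let `m` be the `σ`-mean of
`P^{⊗t}`. Transitivity and Haar invariance make `⟨m, P^{⊗t}⟩ = λ_t` for every `P`, hence `‖m‖² =
λ_t`, and all the vectors `P^{⊗t} - m` have the same norm `D = √(k^t - λ_t)`. A cubature is exact on
the coordinates of `P^{⊗t}`, so `Y_i = P_i^{⊗t} - m` are independent and centred, and the double sum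
of kernels minus `n² λ_t` is `‖∑ Y_i‖²`.

It remains to bound the tail of `‖∑ Y_i‖`. By `cosh_norm_add_le`, adding an independent centred
vector of norm `D` multiplies the mean of `cosh ‖S‖` by at most `cosh D`; iterating and applying
Markov's inequality gives the Hoeffding bound `2 exp(-r² / (2nD²))`. With `r² = τ² n k^t` the
exponent is `(τ²/2) / (1 - λ_t/k^t) ≥ Ψ_τ(n)`, and `r_τ(n) ≥ 1`, so the bound obtained is stronger
than the one claimed. -/

/-! ### Hyperbolic cosine of the norm of a sum -/

/-- Convexity of `s ↦ cosh √s`, written without square roots. -/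
theorem cosh_le_convex_comb {a b y p q : ℝ} (hp : 0 ≤ p) (hq : 0 ≤ q) (hpq : p + q = 1)
    (h : y ^ 2 = p * a ^ 2 + q * b ^ 2) :
    Real.cosh y ≤ p * Real.cosh a + q * Real.cosh b := by
  -- Compare the series `∑ (y²)^j / (2j)!` termwise: each `s ↦ s^j` is convex on `s ≥ 0`.
  refine hasSum_le (fun j => ?_) (Real.hasSum_cosh y)
    (((Real.hasSum_cosh a).mul_left p).add ((Real.hasSum_cosh b).mul_left q))
  have hc := (convexOn_pow (𝕜 := ℝ) j).2 (Set.mem_Ici.mpr (sq_nonneg a))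
    (Set.mem_Ici.mpr (sq_nonneg b)) hp hq hpq
  simp only [smul_eq_mul] at hc
  rw [pow_mul, pow_mul, pow_mul, h, ← mul_div_assoc, ← mul_div_assoc, ← add_div]
  gcongr

/-- With `c` the cosine of the angle, `‖x + y‖²` is the convex combination of `(‖x‖ ± ‖y‖)²` with
weights `(1 ± c)/2`; the addition formulas for `cosh` do the rest. For fixed `‖y‖` the last term is
linear in `y`, so it averages to zero when `y` is centred. -/
theorem cosh_norm_add_le {E : Type*} [NormedAddCommGroup E] [InnerProductSpace ℝ E] (x y : E) :
    Real.cosh ‖x + y‖ ≤ Real.cosh ‖x‖ * Real.cosh ‖y‖ +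
      inner ℝ x y * (Real.sinh ‖x‖ / ‖x‖) * (Real.sinh ‖y‖ / ‖y‖) := by
  rcases eq_or_ne x 0 with rfl | hx
  · simp
  rcases eq_or_ne y 0 with rfl | hy
  · simp
  have hX : 0 < ‖x‖ := norm_pos_iff.mpr hx
  have hY : 0 < ‖y‖ := norm_pos_iff.mpr hy
  obtain ⟨c, hc⟩ : ∃ c, c = inner ℝ x y / (‖x‖ * ‖y‖) := ⟨_, rfl⟩
  have habs : |c| ≤ 1 := hc ▸ abs_real_inner_div_norm_mul_norm_le_one x y
  have hin : inner ℝ x y = c * (‖x‖ * ‖y‖) := by rw [hc]; field_simp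
  obtain ⟨h1, h2⟩ := abs_le.mp habs
  have hns : ‖x + y‖ ^ 2 =
      ((1 + c) / 2) * (‖x‖ + ‖y‖) ^ 2 + ((1 - c) / 2) * (‖x‖ - ‖y‖) ^ 2 := by
    rw [norm_add_sq_real, hin]; ring
  have := cosh_le_convex_comb (by linarith) (by linarith) (by ring) hns
  rw [Real.cosh_add, Real.cosh_sub] at this
  refine this.trans (le_of_eq ?_)
  rw [hin]
  field_simp
  ring

theorem ae_norm_sum_le {E Ω ι : Type*} [NormedAddCommGroup E] [MeasurableSpace Ω]
    {μ : Measure Ω} {Y : ι → Ω → E} {D : ℝ} (hD : ∀ i, ∀ᵐ ω ∂μ, ‖Y i ω‖ = D) (s : Finset ι) :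
    ∀ᵐ ω ∂μ, ‖∑ i ∈ s, Y i ω‖ ≤ s.card * D := by
  have h : ∀ᵐ ω ∂μ, ∀ i ∈ s, ‖Y i ω‖ = D :=
    (ae_ball_iff s.countable_toSet).mpr fun i _ => hD i
  filter_upwards [h] with ω hω
  refine (norm_sum_le _ _).trans ?_
  rw [Finset.sum_congr rfl hω]
  simp

/-! ### Hoeffding's inequality for vectors of constant norm -/

section Hoeffding

variable {E : Type*} [NormedAddCommGroup E] [InnerProductSpace ℝ E] [FiniteDimensional ℝ E]
  [MeasurableSpace E] [BorelSpace E]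
  {Ω ι : Type*} [MeasurableSpace Ω] {μ : Measure Ω} [IsProbabilityMeasure μ]
  {Y : ι → Ω → E} {D : ℝ}

theorem integrable_cosh_norm_sum (hm : ∀ i, AEMeasurable (Y i) μ)
    (hD : ∀ i, ∀ᵐ ω ∂μ, ‖Y i ω‖ = D) (s : Finset ι) :
    Integrable (fun ω => Real.cosh ‖∑ i ∈ s, Y i ω‖) μ := by
  refine Integrable.of_bound (C := Real.cosh (s.card * D)) ?_ ?_
  · exact (Real.continuous_cosh.measurable.comp_aemeasurable
      (Finset.aemeasurable_fun_sum s fun i _ => hm i).norm).aestronglyMeasurable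
  · filter_upwards [ae_norm_sum_le hD s] with ω hω
    rw [Real.norm_eq_abs, abs_of_pos (Real.cosh_pos _), Real.cosh_le_cosh, abs_of_nonneg (norm_nonneg _)]
    exact hω.trans (le_abs_self _)

/-- Add one vector at a time. Constancy of the norm makes the factor `sinh ‖Y a‖ / ‖Y a‖`
deterministic, so by independence the cross term has mean proportional to `⟨𝔼 g(S), 𝔼 Y a⟩ = 0`. -/
theorem integral_cosh_norm_sum_le (hm : ∀ i, AEMeasurable (Y i) μ) (hi : iIndepFun Y μ)
    (hD : ∀ i, ∀ᵐ ω ∂μ, ‖Y i ω‖ = D) (h0 : ∀ i, ∫ ω, Y i ω ∂μ = 0) (s : Finset ι) :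
    ∫ ω, Real.cosh ‖∑ i ∈ s, Y i ω‖ ∂μ ≤ Real.cosh D ^ s.card := by
  classical
  induction s using Finset.induction_on with
  | empty => simp
  | insert a s ha ih =>
    have hS : AEMeasurable (fun ω => ∑ i ∈ s, Y i ω) μ :=
      Finset.aemeasurable_fun_sum s fun i _ => hm i
    have hind : IndepFun (fun ω => ∑ i ∈ s, Y i ω) (Y a) μ := by
      simpa only [Finset.sum_fn] using hi.indepFun_finsetSum_of_notMem₀ hm ha
    set g : E → E := fun x => (Real.sinh ‖x‖ / ‖x‖) • x with hg
    have hgm : Measurable g :=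
      ((Real.continuous_sinh.measurable.comp measurable_norm).div measurable_norm).smul
        measurable_id
    have hgi : Integrable (fun ω => g (∑ i ∈ s, Y i ω)) μ := by
      refine Integrable.of_bound (C := Real.sinh (s.card * D))
        (hgm.comp_aemeasurable hS).aestronglyMeasurable ?_
      filter_upwards [ae_norm_sum_le hD s] with ω hω
      generalize (∑ i ∈ s, Y i ω) = x at hω
      rcases eq_or_ne x 0 with rfl | hx
      · simpa [hg, Real.sinh_nonneg_iff] using hω
      · have hx' : ‖x‖ ≠ 0 := norm_ne_zero_iff.mpr hx
        rw [hg]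
        simp only [norm_smul, norm_div, Real.norm_eq_abs, Real.abs_sinh]
        rw [abs_of_nonneg (norm_nonneg x), div_mul_cancel₀ _ hx']
        exact Real.sinh_le_sinh.mpr hω
    have hYi : Integrable (Y a) μ := by
      refine Integrable.of_bound (C := D) (hm a).aestronglyMeasurable ?_
      filter_upwards [hD a] with ω hω using hω.le
    have hind' : IndepFun (fun ω => g (∑ i ∈ s, Y i ω)) (Y a) μ := hind.comp hgm measurable_id
    have hin0 : ∫ ω, inner ℝ (g (∑ i ∈ s, Y i ω)) (Y a ω) ∂μ = 0 := by
      have := hind'.integral_bilin hgi hYi (innerSL ℝ)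
      rw [h0 a, map_zero] at this
      exact this
    have hini : Integrable (fun ω => inner ℝ (g (∑ i ∈ s, Y i ω)) (Y a ω)) μ := by
      exact hind'.integrable_bilin hgi hYi (innerSL ℝ)
    have hle : ∀ᵐ ω ∂μ, Real.cosh ‖∑ i ∈ insert a s, Y i ω‖ ≤
        Real.cosh ‖∑ i ∈ s, Y i ω‖ * Real.cosh D +
          inner ℝ (g (∑ i ∈ s, Y i ω)) (Y a ω) * (Real.sinh D / D) := by
      filter_upwards [hD a] with ω hω
      rw [Finset.sum_insert ha, add_comm, ← hω]
      refine (cosh_norm_add_le _ _).trans (le_of_eq ?_)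
      rw [hg]
      simp only [real_inner_smul_left]
      ring
    have hci := integrable_cosh_norm_sum hm hD s
    refine (integral_mono_ae (integrable_cosh_norm_sum hm hD _)
      ((hci.mul_const _).add (hini.mul_const _)) hle).trans ?_
    simp only [Pi.add_apply]
    rw [integral_add (hci.mul_const _) (hini.mul_const _), integral_mul_const, integral_mul_const,
      hin0, zero_mul, add_zero, Finset.card_insert_of_notMem ha, pow_succ]
    gcongr

/-- Hoeffding's inequality for sums of independent centred random vectors of constant norm. -/
theorem measureReal_le_norm_sum_le [Fintype ι] [Nonempty ι] (hm : ∀ i, AEMeasurable (Y i) μ)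
    (hi : iIndepFun Y μ) (hDpos : 0 < D)
    (hD : ∀ i, ∀ᵐ ω ∂μ, ‖Y i ω‖ = D) (h0 : ∀ i, ∫ ω, Y i ω ∂μ = 0) {r : ℝ} (hr : 0 ≤ r) :
    μ.real {ω | r ≤ ‖∑ i, Y i ω‖} ≤
      2 * Real.exp (-(r ^ 2 / (2 * (Fintype.card ι * D ^ 2)))) := by
  have hn : (0 : ℝ) < Fintype.card ι := by exact_mod_cast Fintype.card_pos
  set n : ℝ := (Fintype.card ι : ℝ) with hn_def
  -- This `l` minimizes the exponent `n (lD)²/2 - lr`.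
  obtain ⟨l, hl⟩ : ∃ l, l = r / (n * D ^ 2) := ⟨_, rfl⟩
  have hl0 : 0 ≤ l := by rw [hl]; positivity
  set Z : ι → Ω → E := fun i ω => l • Y i ω with hZ
  have hZm : ∀ i, AEMeasurable (Z i) μ := fun i => (hm i).const_smul l
  have hZi : iIndepFun Z μ := hi.comp (fun _ x => l • x) fun _ => measurable_const_smul l
  have hZD : ∀ i, ∀ᵐ ω ∂μ, ‖Z i ω‖ = l * D := fun i => by
    filter_upwards [hD i] with ω hω
    rw [hZ]
    simp only [norm_smul, hω, Real.norm_eq_abs, abs_of_nonneg hl0]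
  have hZ0 : ∀ i, ∫ ω, Z i ω ∂μ = 0 := fun i => by
    rw [hZ]
    simp only [integral_smul, h0 i, smul_zero]
  have hmain := integral_cosh_norm_sum_le hZm hZi hZD hZ0 Finset.univ
  have hmarkov := mul_meas_ge_le_integral_of_nonneg
    (Filter.Eventually.of_forall fun ω => (Real.cosh_pos ‖∑ i, Z i ω‖).le)
    (integrable_cosh_norm_sum hZm hZD Finset.univ) (Real.cosh (l * r))
  have hsub : {ω | r ≤ ‖∑ i, Y i ω‖} ⊆ {ω | Real.cosh (l * r) ≤ Real.cosh ‖∑ i, Z i ω‖} := by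
    intro ω hω
    simp only [Set.mem_ofPred_eq] at hω ⊢
    rw [hZ]
    simp only [← Finset.smul_sum, norm_smul, Real.norm_eq_abs, abs_of_nonneg hl0]
    rw [Real.cosh_le_cosh, abs_of_nonneg (by positivity), abs_of_nonneg (by positivity)]
    gcongr
  -- The factor 2 of the final bound arises here.
  have hcosh : Real.exp (l * r) / 2 ≤ Real.cosh (l * r) := by
    rw [Real.cosh_eq]
    have := Real.exp_pos (-(l * r))
    linarith
  have hpow : Real.cosh (l * D) ^ (Finset.univ : Finset ι).card ≤
      Real.exp (n * ((l * D) ^ 2 / 2)) := by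
    rw [Finset.card_univ, hn_def, Real.exp_nat_mul]
    exact pow_le_pow_left₀ (Real.cosh_pos _).le (Real.cosh_le_exp_half_sq _) _
  have h1 : Real.exp (l * r) / 2 * μ.real {ω | r ≤ ‖∑ i, Y i ω‖} ≤
      Real.exp (n * ((l * D) ^ 2 / 2)) :=
    calc _ ≤ Real.cosh (l * r) *
          μ.real {ω | Real.cosh (l * r) ≤ Real.cosh ‖∑ i, Z i ω‖} :=
          mul_le_mul hcosh (measureReal_mono hsub) measureReal_nonneg (Real.cosh_pos _).le
      _ ≤ _ := hmarkov.trans (hmain.trans hpow)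
  have he : -(r ^ 2 / (2 * (n * D ^ 2))) = n * ((l * D) ^ 2 / 2) - l * r := by
    rw [hl]; field_simp; ring
  rw [he, Real.exp_sub]
  have := Real.exp_pos (l * r)
  rw [← mul_div_assoc, le_div_iff₀ this]
  linarith

end Hoeffding

/-! ### Transitivity of the orthogonal action -/

/-- A zero-one vector with `k` ones is a rearrangement of the vector with `k` leading ones. -/
theorem exists_perm_of_zero_one {k d : ℕ} (hkd : k ≤ d) (v : Fin d → ℝ)
    (hv : ∀ i, v i = 0 ∨ v i = 1) (hsum : ∑ i, v i = k) :
    ∃ e : Equiv.Perm (Fin d), ∀ i, v (e i) = if (i : ℕ) < k then 1 else 0 := by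
  classical
  have hcard : Fintype.card {i : Fin d // (i : ℕ) < k} = Fintype.card {i // v i = 1} := by
    have h1 : ∑ i, v i = ∑ i, if v i = 1 then (1 : ℝ) else 0 :=
      Finset.sum_congr rfl fun i _ => by rcases hv i with h | h <;> simp [h]
    rw [h1, Finset.sum_boole] at hsum
    rw [Fintype.card_subtype, Fintype.card_subtype, Fin.card_filter_val_lt, min_eq_right hkd]
    exact_mod_cast hsum.symm
  let e₀ := Fintype.equivOfCardEq hcard
  refine ⟨e₀.extendSubtype, fun i => ?_⟩
  split_ifs with h
  · exact e₀.extendSubtype_mem i h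
  · exact (hv _).resolve_right (e₀.extendSubtype_not_mem i h)

open Matrix in
/-- The orthogonal group acts transitively on the Grassmann space. -/
theorem exists_conj_baseProj_eq {k d : ℕ} (hkd : k ≤ d) (P : Grass k d) :
    ∃ U : Orth d, conj U (baseProj hkd) = P := by
  obtain ⟨A, hsymm, hidem, htr⟩ := P
  have hA : A.IsHermitian := by
    rw [Matrix.IsHermitian, Matrix.conjTranspose_eq_transpose_of_trivial, hsymm]
  set V : Matrix (Fin d) (Fin d) ℝ := hA.eigenvectorUnitary.1
  have hVV : V * Vᵀ = 1 := by
    have h := Matrix.mem_unitaryGroup_iff.mp hA.eigenvectorUnitary.2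
    rwa [Matrix.star_eq_conjTranspose, Matrix.conjTranspose_eq_transpose_of_trivial] at h
  have hVV' : Vᵀ * V = 1 := mul_eq_one_comm.mp hVV
  have hdiag : A = V * diagonal hA.eigenvalues * Vᵀ := by
    have h := hA.spectral_theorem
    rw [Unitary.conjStarAlgAut_apply] at h
    simpa [Matrix.star_eq_conjTranspose, Matrix.conjTranspose_eq_transpose_of_trivial,
      Function.comp_def] using h
  have hdd : diagonal hA.eigenvalues = Vᵀ * A * V := by
    calc diagonal hA.eigenvalues = (Vᵀ * V) * diagonal hA.eigenvalues * (Vᵀ * V) := by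
          rw [hVV', one_mul, mul_one]
      _ = Vᵀ * (V * diagonal hA.eigenvalues * Vᵀ) * V := by noncomm_ring
      _ = Vᵀ * A * V := by rw [← hdiag]
  -- Idempotence passes to the eigenvalues, forcing them to be 0 or 1; the trace then counts the
  -- ones.
  have hsq : diagonal hA.eigenvalues * diagonal hA.eigenvalues = diagonal hA.eigenvalues := by
    rw [hdd]
    calc Vᵀ * A * V * (Vᵀ * A * V) = Vᵀ * A * (V * Vᵀ) * A * V := by noncomm_ring
      _ = Vᵀ * A * V := by rw [hVV, mul_one, mul_assoc Vᵀ A A, hidem]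
  have hev : ∀ i, hA.eigenvalues i = 0 ∨ hA.eigenvalues i = 1 := fun i => by
    rw [diagonal_mul_diagonal] at hsq
    have h := congrFun (diagonal_injective hsq) i
    have h' : hA.eigenvalues i * (hA.eigenvalues i - 1) = 0 := by
      linarith
    rcases mul_eq_zero.mp h' with h | h
    · exact Or.inl h
    · exact Or.inr (by linarith)
  have hsum : ∑ i, hA.eigenvalues i = k := by
    rw [← htr, hA.trace_eq_sum_eigenvalues]
    simp
  obtain ⟨e, he⟩ := exists_perm_of_zero_one hkd _ hev hsum
  -- The orthogonal matrix sought is `V` with its columns reordered so that the eigenvectors for 1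
  -- come first.
  have hW : V.submatrix id e * (V.submatrix id e)ᵀ = 1 := by
    rw [transpose_submatrix, submatrix_mul_equiv, hVV, submatrix_id_id]
  refine ⟨⟨V.submatrix id e, ?_⟩, Subtype.ext ?_⟩
  · rw [Matrix.mem_unitaryGroup_iff, Matrix.star_eq_conjTranspose,
      Matrix.conjTranspose_eq_transpose_of_trivial]
    exact hW
  · change V.submatrix id e * diagonal (fun i : Fin d => if (i : ℕ) < k then 1 else 0) *
      (V.submatrix id e)ᵀ = A
    have hd : diagonal (fun i : Fin d => if (i : ℕ) < k then (1 : ℝ) else 0) =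
        (diagonal hA.eigenvalues).submatrix e e := by
      rw [submatrix_diagonal_equiv]
      congr 1
      ext i
      exact (he i).symm
    rw [hd, submatrix_mul_equiv, transpose_submatrix, submatrix_mul_equiv, submatrix_id_id, ← hdiag]

/-! ### Invariant measure and its constant potential -/

section Sigma

variable {k d : ℕ}

theorem continuous_conj_left (P : Grass k d) : Continuous fun U : Orth d => conj U P := by
  refine Continuous.subtype_mk ?_ _
  fun_prop

theorem continuous_kernelK_left (t : ℕ) (Q : Grass k d) :
    Continuous fun P : Grass k d => kernelK t P Q := by
  unfold kernelK
  fun_prop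

theorem kernelK_comm (t : ℕ) (P Q : Grass k d) : kernelK t P Q = kernelK t Q P := by
  rw [kernelK, kernelK, Matrix.trace_mul_comm]

theorem kernelK_self (t : ℕ) (P : Grass k d) : kernelK t P P = (k : ℝ) ^ t := by
  rw [kernelK, P.2.2.1, P.2.2.2]

theorem kernelK_conj_conj (t : ℕ) (U V : Orth d) (P Q : Grass k d) :
    kernelK t (conj (V * U) P) (conj V Q) = kernelK t (conj U P) Q := by
  have hV : V.1.transpose * V.1 = 1 := by
    have h := Matrix.mem_unitaryGroup_iff'.mp V.2
    rwa [Matrix.star_eq_conjTranspose, Matrix.conjTranspose_eq_transpose_of_trivial] at h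
  unfold kernelK conj
  congr 1
  simp only [Submonoid.coe_mul, Matrix.transpose_mul]
  calc (V.1 * U.1 * P.1 * (U.1.transpose * V.1.transpose) * (V.1 * Q.1 * V.1.transpose)).trace
      = (V.1 * (U.1 * P.1 * U.1.transpose * (V.1.transpose * V.1) * Q.1 * V.1.transpose)).trace := by
        congr 1; noncomm_ring
    _ = (U.1 * P.1 * U.1.transpose * Q.1 * (V.1.transpose * V.1)).trace := by
        rw [Matrix.trace_mul_comm, hV]; congr 1; rw [mul_one, mul_assoc, hV]
    _ = _ := by rw [hV, mul_one]

instance instIsProbabilityMeasureHaarOrth (d : ℕ) : IsProbabilityMeasure (haarOrth d) :=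
  ⟨by simpa [haarOrth] using Measure.haarMeasure_self (G := Orth d) (K₀ := ⊤)⟩

instance instIsProbabilityMeasureSigma (hkd : k ≤ d) : IsProbabilityMeasure (sigma hkd) :=
  Measure.isProbabilityMeasure_map (continuous_conj_left _).measurable.aemeasurable

/-- Write `Q = V D_k Vᵀ` by transitivity and translate the Haar variable by `V`; the kernel is
unchanged when both arguments are conjugated by `V`, so `Q` drops out. -/
theorem integral_kernelK_sigma_eq_integral_haarOrth (hkd : k ≤ d) (t : ℕ) (Q : Grass k d) :
    ∫ P, kernelK t P Q ∂(sigma hkd) =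
      ∫ U, kernelK t (conj U (baseProj hkd)) (baseProj hkd) ∂(haarOrth d) := by
  obtain ⟨V, rfl⟩ := exists_conj_baseProj_eq hkd Q
  rw [sigma, integral_map (continuous_conj_left _).measurable.aemeasurable
    (continuous_kernelK_left t _).aestronglyMeasurable]
  have : (haarOrth d).IsMulLeftInvariant := by unfold haarOrth; infer_instance
  rw [← integral_mul_left_eq_self _ V]
  simp only [kernelK_conj_conj]

/-- The potential of `σ` is constant on the Grassmann space. -/
theorem integral_kernelK_sigma (hkd : k ≤ d) (t : ℕ) (Q : Grass k d) :
    ∫ P, kernelK t P Q ∂(sigma hkd) = lam hkd t := by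
  rw [lam]
  simp only [integral_kernelK_sigma_eq_integral_haarOrth, integral_const, probReal_univ, one_smul]

end Sigma

/-! ### Tensor powers as a feature map -/

section Tensor

variable {k d : ℕ}

/-- The tensor power `P^{⊗ t}`, a feature map of the kernel `K_t`. -/
noncomputable def tensorPow (t : ℕ) (P : Grass k d) :
    EuclideanSpace ℝ (Fin t → Fin d × Fin d) :=
  WithLp.toLp 2 fun f => ∏ i, P.1 (f i).1 (f i).2

theorem continuous_tensorPow (t : ℕ) :
    Continuous (tensorPow t : Grass k d → EuclideanSpace ℝ (Fin t → Fin d × Fin d)) := by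
  refine (PiLp.continuous_toLp 2 _).comp (continuous_pi fun f => ?_)
  refine continuous_finsetProd _ fun i _ => ?_
  exact continuous_subtype_val.matrix_elem _ _

/-- Symmetry of `Q` turns `trace(PQ)` into the entrywise sum `∑ P_ij Q_ij`, whose `t`-th power
expands over sequences of `t` index pairs. -/
theorem inner_tensorPow (t : ℕ) (P Q : Grass k d) :
    inner ℝ (tensorPow t P) (tensorPow t Q) = kernelK t P Q := by
  have htr : (P.1 * Q.1).trace = ∑ x : Fin d × Fin d, P.1 x.1 x.2 * Q.1 x.1 x.2 := by
    rw [Fintype.sum_prod_type, Matrix.trace]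
    refine Finset.sum_congr rfl fun i _ => ?_
    rw [Matrix.diag_apply, Matrix.mul_apply]
    refine Finset.sum_congr rfl fun j _ => ?_
    rw [← congrFun (congrFun Q.2.1 j) i, Matrix.transpose_apply]
  rw [kernelK, htr, Finset.sum_pow', Fintype.piFinset_univ, PiLp.inner_apply]
  refine Finset.sum_congr rfl fun f _ => ?_
  simp only [tensorPow, RCLike.inner_apply, conj_trivial, Finset.prod_mul_distrib]
  ring

theorem norm_tensorPow_sq (t : ℕ) (P : Grass k d) : ‖tensorPow t P‖ ^ 2 = (k : ℝ) ^ t := by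
  rw [← real_inner_self_eq_norm_sq, inner_tensorPow, kernelK_self]

theorem integrable_tensorPow (t : ℕ) (ν : Measure (Grass k d)) [IsFiniteMeasure ν] :
    Integrable (tensorPow t) ν := by
  refine Integrable.of_bound (C := √((k : ℝ) ^ t))
    (continuous_tensorPow t).aestronglyMeasurable (Filter.Eventually.of_forall fun P => ?_)
  rw [← norm_tensorPow_sq t P, Real.sqrt_sq (norm_nonneg _)]

theorem tensorPow_apply_mem_Pol (t : ℕ) (f : Fin t → Fin d × Fin d) :
    (fun P : Grass k d => tensorPow t P f) ∈ Pol k d t := by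
  refine ⟨∏ i, MvPolynomial.X (f i), ?_, fun P => ?_⟩
  · refine (MvPolynomial.totalDegree_finsetProd _ _).trans ?_
    simp
  · simp [tensorPow, map_prod]

/-- A cubature integrates the feature map exactly. -/
theorem integral_tensorPow_eq {hkd : k ≤ d} {t : ℕ} {ν : Measure (Grass k d)}
    (hν : IsProbabilisticCubature hkd t ν) :
    ∫ P, tensorPow t P ∂ν = ∫ P, tensorPow t P ∂(sigma hkd) := by
  have := hν.isProbabilityMeasure
  ext f
  have h := hν.integral_eq _ (tensorPow_apply_mem_Pol t f)
  have key : ∀ ρ : Measure (Grass k d), IsProbabilityMeasure ρ →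
      (∫ P, tensorPow t P ∂ρ) f = ∫ P, tensorPow t P f ∂ρ := fun ρ _ =>
    ((EuclideanSpace.proj (𝕜 := ℝ) f).integral_comp_comm (integrable_tensorPow t ρ)).symm
  rw [key ν this, key (sigma hkd) inferInstance, h]

/-- The mean of the feature map under `σ`. -/
noncomputable def tensorMean (hkd : k ≤ d) (t : ℕ) : EuclideanSpace ℝ (Fin t → Fin d × Fin d) :=
  ∫ P, tensorPow t P ∂(sigma hkd)

theorem inner_tensorMean_tensorPow (hkd : k ≤ d) (t : ℕ) (Q : Grass k d) :
    inner ℝ (tensorMean hkd t) (tensorPow t Q) = lam hkd t := by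
  rw [tensorMean, real_inner_comm, ← integral_inner (integrable_tensorPow t _),
    ← integral_kernelK_sigma hkd t Q]
  simp only [inner_tensorPow, kernelK_comm t Q]

theorem norm_tensorMean_sq (hkd : k ≤ d) (t : ℕ) : ‖tensorMean hkd t‖ ^ 2 = lam hkd t := by
  rw [← real_inner_self_eq_norm_sq]
  nth_rw 2 [tensorMean]
  rw [← integral_inner (integrable_tensorPow t _)]
  simp only [inner_tensorMean_tensorPow, integral_const, probReal_univ, one_smul]

/-- All feature vectors lie on one sphere about their mean, which is the constant-norm hypothesis of
the Hoeffding bound. -/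
theorem norm_tensorPow_sub_tensorMean_sq (hkd : k ≤ d) (t : ℕ) (P : Grass k d) :
    ‖tensorPow t P - tensorMean hkd t‖ ^ 2 = (k : ℝ) ^ t - lam hkd t := by
  rw [norm_sub_sq_real, norm_tensorPow_sq, norm_tensorMean_sq, real_inner_comm,
    inner_tensorMean_tensorPow]
  ring

theorem lam_le_pow (hkd : k ≤ d) (t : ℕ) : lam hkd t ≤ (k : ℝ) ^ t := by
  have h := norm_tensorPow_sub_tensorMean_sq hkd t (baseProj hkd)
  have := sq_nonneg ‖tensorPow t (baseProj hkd) - tensorMean hkd t‖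
  linarith

theorem norm_sum_tensorPow_sub_tensorMean_sq (hkd : k ≤ d) (t : ℕ) {n : ℕ}
    (P : Fin n → Grass k d) :
    ‖∑ i, (tensorPow t (P i) - tensorMean hkd t)‖ ^ 2 =
      ∑ i, ∑ j, kernelK t (P i) (P j) - (n : ℝ) ^ 2 * lam hkd t := by
  have h : ∀ i j, inner ℝ (tensorPow t (P i) - tensorMean hkd t)
      (tensorPow t (P j) - tensorMean hkd t) = kernelK t (P i) (P j) - lam hkd t := fun i j => by
    rw [inner_sub_left, inner_sub_right, inner_sub_right, inner_tensorPow,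
      real_inner_comm, inner_tensorMean_tensorPow, inner_tensorMean_tensorPow,
      real_inner_self_eq_norm_sq, norm_tensorMean_sq]
    ring
  rw [← real_inner_self_eq_norm_sq, sum_inner]
  simp only [inner_sum, h]
  simp only [ Finset.sum_sub_distrib, Finset.sum_const, Finset.card_univ,
    Fintype.card_fin, nsmul_eq_mul]
  ring

end Tensor

/-! ### The tail bound for cubature points -/

theorem one_le_rTau {k d : ℕ} (hkd : k ≤ d) (t : ℕ) (τ : ℝ) (n : ℕ) : 1 ≤ rTau hkd t τ n := by
  unfold rTau
  have : 0 ≤ 6 / ((n : ℝ) * τ ^ 2 *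
    Real.log (1 + τ / (√(n : ℝ) * (1 - lam hkd t / (k : ℝ) ^ t))) ^ 2) := by positivity
  linarith

theorem mainTheorem7 {k d : ℕ} (hk : 1 ≤ k) (hkd : k ≤ d) (t : ℕ)
    (ν : Measure (Grass k d)) (hν : IsProbabilisticCubature hkd t ν)
    {Ω : Type*} [MeasurableSpace Ω] (μ : Measure Ω) [IsProbabilityMeasure μ]
    (n : ℕ) (hn : 1 ≤ n) (P : Fin n → Ω → Grass k d)
    (hlaw : ∀ i, HasLaw (P i) ν μ) (hindep : iIndepFun P μ)
    (τ : ℝ) (hτ : 0 < τ) :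
    μ.real {ω | τ ^ 2 * (k : ℝ) ^ t / n ≤
        (1 / (n : ℝ) ^ 2) * ∑ i, ∑ j, kernelK t (P i ω) (P j ω) - lam hkd t
          - (1 / (n : ℝ)) * ((k : ℝ) ^ t - lam hkd t)}
      ≤ 4 * Real.exp (-Psi hkd t τ n) * rTau hkd t τ n := by
  have hn0 : (0 : ℝ) < n := by exact_mod_cast hn
  have hkt : (0 : ℝ) < (k : ℝ) ^ t := by
    have : (0 : ℝ) < k := by exact_mod_cast hk
    positivity
  have hlam := lam_le_pow hkd t
  have := hν.isProbabilityMeasure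
  have : Nonempty (Fin n) := ⟨⟨0, hn⟩⟩
  set D : ℝ := √((k : ℝ) ^ t - lam hkd t) with hDdef
  have hDsq : D ^ 2 = (k : ℝ) ^ t - lam hkd t := Real.sq_sqrt (by linarith)
  set Y : Fin n → Ω → EuclideanSpace ℝ (Fin t → Fin d × Fin d) :=
    fun i ω => tensorPow t (P i ω) - tensorMean hkd t with hY
  have hYD : ∀ i ω, ‖Y i ω‖ = D := fun i ω => by
    rw [hDdef, ← norm_tensorPow_sub_tensorMean_sq hkd t (P i ω), Real.sqrt_sq (norm_nonneg _)]
  have hψ : Measurable fun Q : Grass k d => tensorPow t Q - tensorMean hkd t :=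
    ((continuous_tensorPow t).sub continuous_const).measurable
  have hYm : ∀ i, AEMeasurable (Y i) μ := fun i => hψ.comp_aemeasurable (hlaw i).aemeasurable
  have hYi : iIndepFun Y μ := hindep.comp _ fun _ => hψ
  have hY0 : ∀ i, ∫ ω, Y i ω ∂μ = 0 := fun i => by
    have h := (hlaw i).integral_comp (f := fun Q => tensorPow t Q - tensorMean hkd t)
      hψ.aestronglyMeasurable
    rw [integral_sub (integrable_tensorPow t ν) (integrable_const _), integral_tensorPow_eq hν,
      integral_const, probReal_univ, one_smul, ← tensorMean, sub_self] at h
    exact h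
  set r : ℝ := τ * √(n * (k : ℝ) ^ t) with hr
  have hrsq : r ^ 2 = τ ^ 2 * (n * (k : ℝ) ^ t) := by
    rw [hr, mul_pow, Real.sq_sqrt (by positivity)]
  have hrpos : 0 < r := by positivity
  have hsub : {ω | τ ^ 2 * (k : ℝ) ^ t / n ≤
        (1 / (n : ℝ) ^ 2) * ∑ i, ∑ j, kernelK t (P i ω) (P j ω) - lam hkd t
          - (1 / (n : ℝ)) * ((k : ℝ) ^ t - lam hkd t)} ⊆ {ω | r ≤ ‖∑ i, Y i ω‖} := by
    intro ω hω
    simp only [Set.mem_ofPred_eq] at hω ⊢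
    refine le_of_sq_le_sq ?_ (norm_nonneg _)
    rw [hrsq, hY, norm_sum_tensorPow_sub_tensorMean_sq]
    -- Multiplied by `n²`, the event reads `‖∑ Y_i‖² ≥ r² + n (k^t - λ_t)`; the last term,
    -- nonnegative, is discarded.
    have h2 := mul_le_mul_of_nonneg_left hω (sq_nonneg (n : ℝ))
    have e1 : (n : ℝ) ^ 2 * (τ ^ 2 * (k : ℝ) ^ t / n) = τ ^ 2 * (n * (k : ℝ) ^ t) := by
      field_simp
    have e2 : ∀ S : ℝ, (n : ℝ) ^ 2 * ((1 / (n : ℝ) ^ 2) * S - lam hkd t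
          - (1 / (n : ℝ)) * ((k : ℝ) ^ t - lam hkd t)) =
        S - (n : ℝ) ^ 2 * lam hkd t - n * ((k : ℝ) ^ t - lam hkd t) := fun S => by
      field_simp
    rw [e1, e2] at h2
    nlinarith
  refine (measureReal_mono hsub).trans ?_
  have hr1 := one_le_rTau hkd t τ n
  rcases hlam.eq_or_lt with heq | hlt
  -- Degenerate case: every `Y_i` vanishes, while `r > 0`.
  · have hD0 : D = 0 := by rw [hDdef, heq, sub_self, Real.sqrt_zero]
    have hempty : {ω | r ≤ ‖∑ i, Y i ω‖} = ∅ := by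
      refine Set.eq_empty_iff_forall_notMem.mpr fun ω hω => ?_
      have h0 : ∀ i, Y i ω = 0 := fun i => norm_eq_zero.mp ((hYD i ω).trans hD0)
      simp only [Set.mem_ofPred_eq, h0, Finset.sum_const_zero, norm_zero] at hω
      linarith
    rw [hempty, measureReal_empty]
    positivity
  · have hDpos : 0 < D := Real.sqrt_pos.mpr (by linarith)
    refine (measureReal_le_norm_sum_le hYm hYi hDpos
      (fun i => Filter.Eventually.of_forall (hYD i)) hY0 hrpos.le).trans ?_
    have hb : 0 < 1 - lam hkd t / (k : ℝ) ^ t := by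
      rw [sub_pos, div_lt_one hkt]; exact hlt
    -- The summand `τ/(3√n)` in the denominator of `Ψ` only lowers the exponent.
    have hexp : Psi hkd t τ n ≤ r ^ 2 / (2 * (Fintype.card (Fin n) * D ^ 2)) := by
      have e : r ^ 2 / (2 * (Fintype.card (Fin n) * D ^ 2)) =
          (τ ^ 2 / 2) / (1 - lam hkd t / (k : ℝ) ^ t) := by
        have : (k : ℝ) ^ t - lam hkd t ≠ 0 := by linarith
        rw [hrsq, hDsq, Fintype.card_fin, one_sub_div hkt.ne']
        field_simp
      rw [e, Psi]
      exact div_le_div_of_nonneg_left (by positivity) hb (le_add_of_nonneg_right (by positivity))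
    calc _ ≤ 2 * Real.exp (-Psi hkd t τ n) := by gcongr
      _ ≤ 4 * Real.exp (-Psi hkd t τ n) * 1 := by
        have := Real.exp_pos (-Psi hkd t τ n)
        linarith
      _ ≤ _ := by gcongr
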